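/- Let $\mathrm{CGp}$ be the category whose objects are the compact Hausdorff topological groups and whose morphisms are the continuous group homomorphisms. Call a morphism $\iota\colon H\to G$ of $\mathrm{CGp}$ an embedding if it is a homeomorphism onto its image $\iota(H)\le G$ (with the subspace topology), and a regular monomorphism if it is an equalizer in $\mathrm{CGp}$ of some pair of parallel morphisms $G\rightrightarrows K$. Then: 1. A morphism of $\mathrm{CGp}$ is a regular monomorphism if and only if it is an embedding. In particular, every embedding of compact Hausdorff groups is an equalizer in $\mathrm{CGp}$. 2. For every embedding $\iota\colon H\to G$ in $\mathrm{CGp}$, the pushout $G\sqcup_H G$ of $\iota$ along itself exists in $\mathrm{CGp}$, and $\iota$ is the equalizer in $\mathrm{CGp}$ of the two structure maps $G\rightrightarrows G\sqcup_H G$. -/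

import Mathlib

open CategoryTheory CategoryTheory.Limits

universe u

/-- Compact Hausdorff topological groups. -/
structure CompactGrp : Type (u + 1) where
  /-- The underlying type. -/
  carrier : Type u
  [group : Group carrier]
  [topologicalSpace : TopologicalSpace carrier]
  [isTopologicalGroup : IsTopologicalGroup carrier]
  [compactSpace : CompactSpace carrier]
  [t2Space : T2Space carrier]

namespace CompactGrp

instance : CoeSort CompactGrp.{u} (Type u) where
  coe G := G.carrier

attribute [instance] group topologicalSpace isTopologicalGroup compactSpace t2Space

/-- The object given by a type that carries the structure of a compact Hausdorff group. -/
abbrev of (G : Type u) [Group G] [TopologicalSpace G] [IsTopologicalGroup G]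
    [CompactSpace G] [T2Space G] : CompactGrp.{u} where
  carrier := G

/-- Morphisms of compact groups are the continuous group homomorphisms. -/
@[ext]
structure Hom (G K : CompactGrp.{u}) where
  /-- The underlying continuous group homomorphism. -/
  hom' : G →ₜ* K

/-- The category of compact Hausdorff groups and continuous group homomorphisms. -/
instance : Category CompactGrp.{u} where
  Hom G K := Hom G K
  id G := ⟨ContinuousMonoidHom.id G⟩
  comp f g := ⟨g.hom'.comp f.hom'⟩

instance : ConcreteCategory CompactGrp.{u} (fun G K => G →ₜ* K) where
  hom f := f.hom'
  ofHom f := ⟨f⟩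

/-- A morphism is an embedding if its underlying map is a homeomorphism onto its image
(so that it identifies its source, as a topological group, with a subgroup of its target). -/
def IsEmbedding {H G : CompactGrp.{u}} (f : H ⟶ G) : Prop :=
  Topology.IsEmbedding (ConcreteCategory.hom f : H → G)

end CompactGrp

/-! Everything rests on one separation statement, `exists_continuousMonoidHom_pair`: a closed
subgroup `H` and a point `x` outside it are told apart by two homomorphisms `a`, `b` to some O(n). A
Peter–Weyl argument on L² gives a finite-dimensional representation `a` with an `H`-fixed vector `w`
whose line does not contain `a x w`; `b` is `a` conjugated by the reflection in that line. The
pushout is the closed subgroup generated by both groups in a product of O(n)'s indexed by compatible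
pairs of representations, a small family. It is universal because every compact group embeds in such
a product. Applied to the image of an embedding, separation identifies that image with the
equalizer. Conversely, an equalizer is injective, and compactness makes it an embedding. -/

open MeasureTheory Module.End Topology

/-! ### Finite-dimensional invariant subspaces -/

section Representation

variable {G E : Type*} [Group G] [TopologicalSpace G] [IsTopologicalGroup G] [CompactSpace G]
  [NormedAddCommGroup E] [InnerProductSpace ℝ E] [CompleteSpace E]

/-- Averaging a rank-one operator over a compact group gives a compact symmetric operator that
commutes with the group. -/
theorem exists_isCompactOperator_isSymmetric_commute (ρ : G →* (E ≃ₗᵢ[ℝ] E))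
    (hρ : ∀ v, Continuous fun g => ρ g v) {w : E} (hw : w ≠ 0) :
    ∃ T : E →L[ℝ] E, IsCompactOperator T ∧ T.IsSymmetric ∧
      (∀ g v, T (ρ g v) = ρ g (T v)) ∧ T w ≠ 0 := by
  let _ : MeasurableSpace G := borel G
  have : BorelSpace G := ⟨rfl⟩
  let μ : Measure G := Measure.haar
  let F : G → E →L[ℝ] E := fun g => InnerProductSpace.rankOne ℝ (ρ g w) (ρ g w)
  have hFc : Continuous F :=
    ((InnerProductSpace.rankOne ℝ).continuous.comp (hρ w)).clm_apply (hρ w)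
  have hFi : Integrable F μ := hFc.integrable_of_hasCompactSupport (HasCompactSupport.of_compactSpace F)
  have happ (v : E) : (∫ g, F g ∂μ) v = ∫ g, inner ℝ (ρ g w) v • ρ g w ∂μ := by
    rw [ContinuousLinearMap.integral_apply hFi]
    simp [F, InnerProductSpace.rankOne_apply]
  have hci (v : E) : Continuous fun g => inner ℝ (ρ g w) v := (hρ w).inner continuous_const
  have hi (v : E) : Integrable (fun g => inner ℝ (ρ g w) v • ρ g w) μ :=
    ((hci v).smul (hρ w)).integrable_of_hasCompactSupport (HasCompactSupport.of_compactSpace _)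
  have hinner (v z : E) :
      inner ℝ z ((∫ g, F g ∂μ) v) = ∫ g, inner ℝ (ρ g w) v * inner ℝ (ρ g w) z ∂μ := by
    rw [happ, ← integral_inner (hi v)]
    simp [inner_smul_right, real_inner_comm]
  refine ⟨∫ g, F g ∂μ, ?_, ?_, ?_, ?_⟩
  -- Compact operators form a closed subspace, so the integral can be taken inside it.
  · let S : Submodule ℝ (E →L[ℝ] E) := compactOperator (RingHom.id ℝ) E E
    have hS : IsClosed (S : Set (E →L[ℝ] E)) := isClosed_setOfPred_isCompactOperator
    have hm : ∀ g, F g ∈ S := fun g =>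
      (isCompactOperator_of_locallyCompactSpace_dom (innerSL ℝ (ρ g w))).clm_comp
        (ContinuousLinearMap.toSpanSingleton ℝ (ρ g w))
    have : CompleteSpace S := hS.completeSpace_coe
    let F' : G → S := fun g => ⟨F g, hm g⟩
    have hFi' : Integrable F' μ := (hFc.subtype_mk hm).integrable_of_hasCompactSupport
      (HasCompactSupport.of_compactSpace F')
    have hF : ∫ g, F g ∂μ = ((∫ g, F' g ∂μ : S) : E →L[ℝ] E) :=
      ContinuousLinearMap.integral_comp_comm (𝕜 := ℝ) S.subtypeL hFi'
    rw [hF]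
    exact (∫ g, F' g ∂μ : S).2
  · intro v z
    change inner ℝ ((∫ g, F g ∂μ) v) z = inner ℝ v ((∫ g, F g ∂μ) z)
    rw [real_inner_comm, hinner, hinner]
    simp_rw [mul_comm]
  · intro h v
    rw [happ, happ, ← integral_mul_left_eq_self _ h]
    have : ρ h (∫ g, inner ℝ (ρ g w) v • ρ g w ∂μ) = _ :=
      ((ρ h).toContinuousLinearEquiv.toContinuousLinearMap.integral_comp_comm (hi v)).symm
    rw [this]
    simp [map_smul]
  · intro h0
    -- ⟨w, T w⟩ is the integral of a continuous square that is positive at `g = 1`.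
    have h1 : ∫ g, inner ℝ (ρ g w) w * inner ℝ (ρ g w) w ∂μ = 0 := by rw [← hinner, h0]; simp
    have hc : Continuous fun g => inner ℝ (ρ g w) w * inner ℝ (ρ g w) w := (hci w).mul (hci w)
    have h2 := hc.integral_pos_of_hasCompactSupport_nonneg_nonzero (μ := μ) (x := 1)
      (HasCompactSupport.of_compactSpace _) (fun g => mul_self_nonneg _) (by simpa using hw)
    exact h2.ne' h1

/-- Take `T` with `T (ρ x v - v) ≠ 0`. Its eigenspaces for nonzero eigenvalues are invariant and
finite-dimensional, and the projections of `v` to them are `H`-fixed. If `x` fixed them all, `T (ρ x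
v - v)` would be orthogonal to every eigenspace, hence zero by the spectral theorem. -/
theorem exists_finiteDimensional_invariant (ρ : G →* (E ≃ₗᵢ[ℝ] E))
    (hρ : ∀ v, Continuous fun g => ρ g v) (H : Subgroup G) {x : G} {v : E}
    (hv : ∀ h ∈ H, ρ h v = v) (hx : ρ x v ≠ v) :
    ∃ V : Submodule ℝ E, FiniteDimensional ℝ V ∧ (∀ g, ∀ u ∈ V, ρ g u ∈ V) ∧
      ∃ u ∈ V, (∀ h ∈ H, ρ h u = u) ∧ ρ x u ≠ u := by
  obtain ⟨T, hTc, hTs, hTρ, hT⟩ :=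
    exists_isCompactOperator_isSymmetric_commute ρ hρ (sub_ne_zero.2 hx)
  by_contra! hcon
  have hinv (μ : ℝ) (g : G) (u : E) (hu : u ∈ eigenspace (T : E →ₗ[ℝ] E) μ) :
      ρ g u ∈ eigenspace (T : E →ₗ[ℝ] E) μ := by
    rw [mem_eigenspace_iff] at hu ⊢
    change T _ = _
    rw [hTρ, ← map_smul]
    exact congrArg (ρ g) hu
  have key (μ : ℝ) (hμ : μ ≠ 0) (u : E) (hu : u ∈ eigenspace (T : E →ₗ[ℝ] E) μ) :
      inner ℝ (ρ x v - v) u = 0 := by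
    have := ContinuousLinearMap.finite_dimensional_eigenspace hTc μ hμ
    set K := eigenspace (T : E →ₗ[ℝ] E) μ
    have hmap (g : G) : K.map ((ρ g).toLinearEquiv : E →ₗ[ℝ] E) = K := by
      apply le_antisymm
      · rintro _ ⟨y, hy, rfl⟩
        exact hinv μ g y hy
      · intro y hy
        exact ⟨ρ g⁻¹ y, hinv μ g⁻¹ y hy, by simp [map_inv]⟩
    have hcomm (g : G) (y : E) : K.starProjection (ρ g y) = ρ g (K.starProjection y) := by
      have := Submodule.starProjection_map_apply (ρ g) K (ρ g y)
      simp only [hmap] at this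
      simpa using this
    have hfix := hcon K inferInstance (hinv μ) (K.starProjection v)
      (K.starProjection_apply_mem v) fun h hh => by rw [← hcomm, hv h hh]
    have h0 : K.starProjection (ρ x v - v) = 0 := by rw [map_sub, hcomm, hfix, sub_self]
    rw [Submodule.starProjection_apply_eq_zero_iff] at h0
    exact Submodule.inner_left_of_mem_orthogonal hu h0
  apply hT
  have hmem : T (ρ x v - v) ∈ (⨆ μ, eigenspace (T : E →ₗ[ℝ] E) μ)ᗮ := by
    rw [← Submodule.iInf_orthogonal, Submodule.mem_iInf]
    intro μ
    rw [Submodule.mem_orthogonal']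
    intro u hu
    have h1 : inner ℝ (T (ρ x v - v)) u = inner ℝ (ρ x v - v) (T u) := hTs _ _
    have h2 : T u = μ • u := mem_eigenspace_iff.1 hu
    rw [h1, h2, inner_smul_right]
    -- The kernel may be infinite-dimensional, but there the factor `μ` vanishes.
    by_cases hμ : μ = 0
    · simp [hμ]
    · rw [key μ hμ u hu, mul_zero]
  rwa [ContinuousLinearMap.orthogonalComplement_iSup_eigenspaces_eq_bot hTc hTs,
    Submodule.mem_bot] at hmem

/-- An isometry preserving a real line acts on it by ±1, so the only obstruction is `ρ x u = -u`;
adding the invariant vector `e` to `u` removes it. -/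
theorem exists_finiteDimensional_invariant_notMem_span (ρ : G →* (E ≃ₗᵢ[ℝ] E))
    (hρ : ∀ v, Continuous fun g => ρ g v) (H : Subgroup G) {x : G} {v e : E}
    (hv : ∀ h ∈ H, ρ h v = v) (hx : ρ x v ≠ v) (he : e ≠ 0) (hρe : ∀ g, ρ g e = e) :
    ∃ V : Submodule ℝ E, FiniteDimensional ℝ V ∧ (∀ g, ∀ u ∈ V, ρ g u ∈ V) ∧
      ∃ u ∈ V, (∀ h ∈ H, ρ h u = u) ∧ ρ x u ∉ Submodule.span ℝ {u} := by
  obtain ⟨V, hfin, hV, u, hu, huH, hux⟩ := exists_finiteDimensional_invariant ρ hρ H hv hx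
  have hspan (z : E) (hz : ρ x z ∈ Submodule.span ℝ {z}) : ρ x z = z ∨ ρ x z = -z := by
    obtain ⟨c, hc⟩ := Submodule.mem_span_singleton.1 hz
    by_cases hz0 : z = 0
    · simp [hz0]
    have hn : ‖c‖ * ‖z‖ = 1 * ‖z‖ := by rw [← norm_smul, hc, (ρ x).norm_map, one_mul]
    have hc1 : |c| = 1 := mul_right_cancel₀ (norm_ne_zero_iff.2 hz0) hn
    rcases (abs_eq zero_le_one).1 hc1 with rfl | rfl
    · left; simpa using hc.symm
    · right; simpa using hc.symm
  refine ⟨V ⊔ Submodule.span ℝ {e}, inferInstance, ?_, ?_⟩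
  · intro g z hz
    obtain ⟨y, hy, t, ht, rfl⟩ := Submodule.mem_sup.1 hz
    obtain ⟨c, rfl⟩ := Submodule.mem_span_singleton.1 ht
    rw [map_add, map_smul, hρe]
    exact Submodule.add_mem_sup (hV g y hy) ht
  · by_cases hneg : ρ x u = -u
    · refine ⟨u + e, Submodule.add_mem_sup hu (Submodule.mem_span_singleton_self e), ?_, ?_⟩
      · intro h hh
        rw [map_add, huH h hh, hρe]
      · intro hmem
        rcases hspan _ hmem with h | h <;> rw [map_add, hρe, hneg] at h
        · exact hux (hneg.trans (add_right_cancel h))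
        · rw [neg_add] at h
          have h' := add_left_cancel h
          rw [eq_neg_iff_add_eq_zero, ← two_smul ℝ, smul_eq_zero] at h'
          exact he (h'.resolve_left two_ne_zero)
    · refine ⟨u, Submodule.mem_sup_left hu, huH, fun hmem => ?_⟩
      exact (hspan _ hmem).elim hux hneg

end Representation

/-! ### Orthogonal groups and matrix representations -/

/-- The orthogonal group in dimension `n`. -/
def OrthogonalOperators (n : ℕ) : Type :=
  unitary (EuclideanSpace ℝ (Fin n) →L[ℝ] EuclideanSpace ℝ (Fin n))

instance (n : ℕ) :
    ContinuousStar (EuclideanSpace ℝ (Fin n) →L[ℝ] EuclideanSpace ℝ (Fin n)) where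
  continuous_star := (ContinuousLinearMap.adjoint (𝕜 := ℝ) (E := EuclideanSpace ℝ (Fin n))
    (F := EuclideanSpace ℝ (Fin n))).continuous

namespace OrthogonalOperators

variable (n : ℕ)

noncomputable instance : Group (OrthogonalOperators n) :=
  inferInstanceAs (Group (unitary (EuclideanSpace ℝ (Fin n) →L[ℝ] EuclideanSpace ℝ (Fin n))))

noncomputable instance : TopologicalSpace (OrthogonalOperators n) :=
  inferInstanceAs
    (TopologicalSpace (unitary (EuclideanSpace ℝ (Fin n) →L[ℝ] EuclideanSpace ℝ (Fin n))))

instance : IsTopologicalGroup (OrthogonalOperators n) :=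
  inferInstanceAs
    (IsTopologicalGroup (unitary (EuclideanSpace ℝ (Fin n) →L[ℝ] EuclideanSpace ℝ (Fin n))))

instance : T2Space (OrthogonalOperators n) :=
  inferInstanceAs (T2Space (unitary (EuclideanSpace ℝ (Fin n) →L[ℝ] EuclideanSpace ℝ (Fin n))))

instance : CompactSpace (OrthogonalOperators n) := by
  refine isCompact_iff_compactSpace.1 (Metric.isCompact_of_isClosed_isBounded isClosed_unitary ?_)
  refine (Metric.isBounded_closedBall (x := 0) (r := 1)).subset fun U hU => ?_
  rw [mem_closedBall_zero_iff]
  refine ContinuousLinearMap.opNorm_le_bound _ zero_le_one fun v => ?_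
  rw [one_mul]
  exact (Unitary.norm_map ⟨U, hU⟩ v).le

end OrthogonalOperators

section Representation

variable {G E : Type*} [Group G] [TopologicalSpace G] [NormedAddCommGroup E] [InnerProductSpace ℝ E]

theorem exists_continuousMonoidHom_orthogonalOperators (ρ : G →* (E ≃ₗᵢ[ℝ] E))
    (hρ : ∀ v, Continuous fun g => ρ g v) (V : Submodule ℝ E) [FiniteDimensional ℝ V]
    (hV : ∀ g, ∀ u ∈ V, ρ g u ∈ V) :
    ∃ (n : ℕ) (e : V ≃ₗᵢ[ℝ] EuclideanSpace ℝ (Fin n)) (a : G →ₜ* OrthogonalOperators n),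
      ∀ g (u : V), (a g).1 (e u) = e ⟨ρ g u, hV g u u.2⟩ := by
  let e := (stdOrthonormalBasis ℝ V).repr
  let ρV (g : G) : V ≃ₗᵢ[ℝ] V :=
    { toFun := fun u => ⟨ρ g u, hV g u u.2⟩
      invFun := fun u => ⟨ρ g⁻¹ u, hV g⁻¹ u u.2⟩
      map_add' := fun u w => Subtype.ext (map_add (ρ g) _ _)
      map_smul' := fun c u => Subtype.ext (map_smul (ρ g) c (u : E))
      left_inv := fun u => Subtype.ext (by simp [map_inv])
      right_inv := fun u => Subtype.ext (by simp [map_inv])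
      norm_map' := fun u => (ρ g).norm_map u }
  let a : G →* OrthogonalOperators (Module.finrank ℝ V) :=
    Unitary.linearIsometryEquiv.symm.toMonoidHom.comp
      { toFun := fun g => (e.symm.trans (ρV g)).trans e
        map_one' := by ext v : 1; simp [ρV]
        map_mul' := fun g h => by ext v : 1; simp [ρV] }
  have ha (g : G) (v) : (a g).1 v = e (ρV g (e.symm v)) := rfl
  refine ⟨_, e, ⟨a, ?_⟩, fun g u => ?_⟩
  · refine continuous_induced_rng.2 (continuous_clm_apply.2 fun v => ?_)
    exact e.continuous.comp ((hρ _).subtype_mk _)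
  · change (a g).1 (e u) = _
    rw [ha, e.symm_apply_apply]
    rfl

end Representation

/-! ### Separating points from closed subgroups -/

section Separation

variable {G : Type*} [Group G] [TopologicalSpace G] [IsTopologicalGroup G] [CompactSpace G]

/-- A continuous function separating a point from a closed subgroup and invariant under it. -/
theorem exists_continuousMap_subgroup_invariant (H : Subgroup G) (hH : IsClosed (H : Set G)) {x : G}
    (hx : x ∉ H) :
    ∃ f : C(G, ℝ), (∀ h ∈ H, ∀ y, f (h * y) = f y) ∧ f 1 ≠ f x := by
  have := hH
  let Q := MulAction.orbitRel.Quotient H G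
  let π : G → Q := Quotient.mk _
  have hπ : Continuous π := continuous_quotient_mk'
  -- Closedness of `H` makes its translation action proper.
  have : T2Space Q := t2Space_quotient_mulAction_of_properSMul
  have hne : π 1 ≠ π x := by
    intro h
    obtain ⟨k, hk⟩ := Quotient.exact h
    apply hx
    have hk' : (k : G) * x = 1 := hk
    rw [eq_inv_of_mul_eq_one_right hk']
    exact H.inv_mem k.2
  obtain ⟨f, hf0, hf1, -⟩ := exists_continuous_zero_one_of_isClosed (isClosed_singleton (x := π 1))
    (isClosed_singleton (x := π x)) (by simpa using hne)
  refine ⟨f.comp ⟨π, hπ⟩, fun h hh y => congrArg f (Quotient.sound ⟨⟨h, hh⟩, rfl⟩), ?_⟩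
  have h0 : f (π 1) = 0 := hf0 rfl
  have h1 : f (π x) = 1 := hf1 rfl
  change f (π 1) ≠ f (π x)
  rw [h0, h1]
  exact zero_ne_one

variable [T2Space G]

/-- The left regular representation on square-integrable functions separates points from closed
subgroups. -/
theorem exists_unitary_representation (H : Subgroup G) (hH : IsClosed (H : Set G)) {x : G}
    (hx : x ∉ H) [MeasurableSpace G] [BorelSpace G] :
    ∃ ρ : G →* (Lp ℝ 2 (Measure.haar : Measure G) ≃ₗᵢ[ℝ] Lp ℝ 2 (Measure.haar : Measure G)),
      (∀ v, Continuous fun g => ρ g v) ∧ ∃ v e, (∀ h ∈ H, ρ h v = v) ∧ ρ x v ≠ v ∧ e ≠ 0 ∧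
        ∀ g, ρ g e = e := by
  let μ : Measure G := Measure.haar
  let ρ : G →* (Lp ℝ 2 μ ≃ₗᵢ[ℝ] Lp ℝ 2 μ) :=
    { toFun := fun g =>
        { DistribMulAction.toLinearEquiv ℝ (Lp ℝ 2 μ) (DomMulAct.mk g⁻¹) with
          norm_map' := fun f => DomMulAct.norm_smul_Lp _ f }
      map_one' := by
        ext1 f
        change DomMulAct.mk (1 : G)⁻¹ • f = f
        rw [inv_one, DomMulAct.mk_one, one_smul]
      map_mul' := fun g h => by
        ext1 f
        change DomMulAct.mk (g * h)⁻¹ • f = DomMulAct.mk g⁻¹ • DomMulAct.mk h⁻¹ • f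
        rw [mul_inv_rev, DomMulAct.mk_mul, mul_smul] }
  have hρ (g : G) (f) : ρ g f = DomMulAct.mk g⁻¹ • f := rfl
  have hρL (g : G) (f : C(G, ℝ)) : ρ g (ContinuousMap.toLp 2 μ ℝ f) =
      ContinuousMap.toLp 2 μ ℝ (f.comp ⟨fun y => g⁻¹ * y, continuous_const_mul _⟩) := rfl
  -- Since `ρ x` is precomposition with `x⁻¹ * ·`, its effect at 1 is to read `f` at `x⁻¹`.
  obtain ⟨f, hfH, hf⟩ := exists_continuousMap_subgroup_invariant H hH (x := x⁻¹) (by simpa using hx)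
  refine ⟨ρ, fun v => ?_, ContinuousMap.toLp 2 μ ℝ f, ContinuousMap.toLp 2 μ ℝ 1, fun h hh => ?_,
    fun h => ?_, ?_, fun g => rfl⟩
  · have : Fact ((2 : ENNReal) ≠ ⊤) := ⟨ENNReal.ofNat_ne_top⟩
    simp_rw [hρ]
    exact (DomMulAct.continuous_mk.comp continuous_inv).smul continuous_const
  · rw [hρL]
    congr 1
    ext y
    exact hfH _ (H.inv_mem hh) y
  · rw [hρL, ContinuousMap.toLp_inj] at h
    have h1 : f (x⁻¹ * 1) = f 1 := DFunLike.congr_fun h 1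
    rw [mul_one] at h1
    exact hf h1.symm
  · rw [← map_zero (ContinuousMap.toLp (E := ℝ) 2 μ ℝ), Ne, ContinuousMap.toLp_inj]
    exact one_ne_zero

/-- Two continuous homomorphisms to an orthogonal group that agree on a closed subgroup but not at a
given point outside it. -/
theorem exists_continuousMonoidHom_pair (H : Subgroup G) (hH : IsClosed (H : Set G)) {x : G}
    (hx : x ∉ H) :
    ∃ (n : ℕ) (a b : G →ₜ* OrthogonalOperators n), (∀ h ∈ H, a h = b h) ∧ a x ≠ b x := by
  let _ : MeasurableSpace G := borel G
  have : BorelSpace G := ⟨rfl⟩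
  obtain ⟨ρ, hρ, v, e, hv, hvx, he, hρe⟩ := exists_unitary_representation H hH hx
  obtain ⟨V, hfin, hV, u, hu, huH, hux⟩ :=
    exists_finiteDimensional_invariant_notMem_span ρ hρ H hv hvx he hρe
  obtain ⟨n, e, a, ha⟩ := exists_continuousMonoidHom_orthogonalOperators ρ hρ V hV
  let w := e ⟨u, hu⟩
  have haH (h) (hh : h ∈ H) : (a h).1 w = w := by
    rw [ha]
    exact congrArg e (Subtype.ext (huH h hh))
  have hax : (a x).1 w ∉ Submodule.span ℝ {w} := by
    intro hmem
    obtain ⟨c, hc⟩ := Submodule.mem_span_singleton.1 hmem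
    rw [ha, ← map_smul] at hc
    exact hux (Submodule.mem_span_singleton.2 ⟨c, congrArg Subtype.val (e.injective hc)⟩)
  let K := Submodule.span ℝ {w}
  have hKw : K.reflection w = w :=
    Submodule.reflection_mem_subspace_eq_self (Submodule.mem_span_singleton_self w)
  let R : OrthogonalOperators n := Unitary.linearIsometryEquiv.symm K.reflection
  have hR (z) : R.1 z = K.reflection z := rfl
  have hRR : R⁻¹ = R := inv_eq_of_mul_eq_one_right (Subtype.ext (by
    ext1 z
    exact K.reflection_reflection z))
  let b : G →ₜ* OrthogonalOperators n :=
    ⟨(MulAut.conj R).toMonoidHom.comp a.toMonoidHom,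
      (continuous_const.mul a.continuous).mul continuous_const⟩
  have hb (g) (z) : (b g).1 z = K.reflection ((a g).1 (K.reflection z)) := by
    change (R * a g * R⁻¹).1 z = _
    rw [hRR]
    rfl
  refine ⟨n, a, b, fun h hh => Subtype.ext ?_, fun hab => hax ?_⟩
  -- An isometry fixing `w` commutes with the reflection in its line.
  · have hcomm : R * a h = a h * R := by
      apply Subtype.ext
      ext1 z
      change K.reflection ((a h).1 z) = (a h).1 (K.reflection z)
      have hi (z' : EuclideanSpace ℝ (Fin n)) : inner ℝ w ((a h).1 z') = inner ℝ w z' := by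
        conv_lhs => rw [← haH h hh]
        exact Unitary.inner_map_map (a h) w z'
      rw [Submodule.reflection_singleton_apply, Submodule.reflection_singleton_apply, hi]
      simp [haH h hh]
    change (a h).1 = (R * a h * R⁻¹).1
    rw [hcomm, mul_inv_cancel_right]
  · rw [← Submodule.reflection_eq_self_iff]
    have h1 := hb x w
    rw [hKw, ← hab] at h1
    exact h1.symm

end Separation

/-- Lifting a continuous homomorphism along an embedding whose range contains its range. -/
theorem ContinuousMonoidHom.exists_lift_of_isEmbedding {A B C : Type*} [Group A]
    [TopologicalSpace A] [Group B] [TopologicalSpace B] [Group C] [TopologicalSpace C]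
    (i : B →ₜ* C) (hi : IsEmbedding i) (φ : A →ₜ* C) (h : ∀ s, ∃ k, i k = φ s) :
    ∃ ψ : A →ₜ* B, ∀ s, i (ψ s) = φ s := by
  choose ψ hψ using h
  refine ⟨⟨MonoidHom.mk' ψ fun s t => hi.injective ?_, hi.continuous_iff.2 ?_⟩, hψ⟩
  · rw [map_mul, hψ, hψ, hψ, map_mul]
  · exact φ.continuous.congr fun s => (hψ s).symm

/-! ### Pushouts of compact groups -/

namespace CompactGrp

/-- Continuous homomorphisms to orthogonal groups embed a compact group in a product. -/
theorem isClosedEmbedding_pi_orthogonalOperators (K : CompactGrp.{u}) :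
    IsClosedEmbedding fun (k : K) (j : Σ n, K →ₜ* OrthogonalOperators n) => j.2 k := by
  refine Continuous.isClosedEmbedding (continuous_pi fun j => j.2.continuous) fun k l hkl => ?_
  by_contra hne
  have hx : k * l⁻¹ ∉ (⊥ : Subgroup K) := by
    rwa [Subgroup.mem_bot, mul_inv_eq_one]
  -- Homomorphisms differing at `k * l⁻¹` cannot both be trivial there.
  obtain ⟨n, a, b, -, hab⟩ := exists_continuousMonoidHom_pair (⊥ : Subgroup K)
    (by simp) hx
  have hone (c : K →ₜ* OrthogonalOperators n) : c (k * l⁻¹) = 1 := by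
    rw [map_mul, map_inv, mul_inv_eq_one]
    exact congrFun hkl ⟨n, c⟩
  exact hab ((hone a).trans (hone b).symm)

section Pushout

variable {H G₁ G₂ : CompactGrp.{u}} (f : H ⟶ G₁) (g : H ⟶ G₂)

/-- The pairs of homomorphisms to orthogonal groups that agree on the common source. -/
abbrev PushoutIndex : Type u :=
  Σ n, {p : (G₁ →ₜ* OrthogonalOperators n) × (G₂ →ₜ* OrthogonalOperators n) //
    ∀ h, p.1 (ConcreteCategory.hom f h) = p.2 (ConcreteCategory.hom g h)}

/-- The product of orthogonal groups that contains the pushout. -/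
abbrev PushoutAmbient : Type u := ∀ j : PushoutIndex f g, OrthogonalOperators j.1

/-- The first structure map, with values in the ambient product. -/
noncomputable def pushoutInl : G₁ →ₜ* PushoutAmbient f g :=
  ⟨MonoidHom.pi fun j => j.2.1.1.toMonoidHom, continuous_pi fun j => j.2.1.1.continuous⟩

/-- The second structure map, with values in the ambient product. -/
noncomputable def pushoutInr : G₂ →ₜ* PushoutAmbient f g :=
  ⟨MonoidHom.pi fun j => j.2.1.2.toMonoidHom, continuous_pi fun j => j.2.1.2.continuous⟩

/-- The pushout as a closed subgroup of a product of orthogonal groups. -/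
noncomputable def pushoutSubgroup : Subgroup (PushoutAmbient f g) :=
  ((pushoutInl f g).toMonoidHom.range ⊔ (pushoutInr f g).toMonoidHom.range).topologicalClosure

theorem isClosed_pushoutSubgroup : IsClosed (pushoutSubgroup f g : Set (PushoutAmbient f g)) :=
  Subgroup.isClosed_topologicalClosure _

instance : CompactSpace (pushoutSubgroup f g) :=
  isCompact_iff_compactSpace.1 (isClosed_pushoutSubgroup f g).isCompact

theorem pushoutInl_mem (x : G₁) : pushoutInl f g x ∈ pushoutSubgroup f g :=
  Subgroup.le_topologicalClosure _ (Subgroup.mem_sup_left ⟨x, rfl⟩)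

theorem pushoutInr_mem (x : G₂) : pushoutInr f g x ∈ pushoutSubgroup f g :=
  Subgroup.le_topologicalClosure _ (Subgroup.mem_sup_right ⟨x, rfl⟩)

theorem pushoutSubgroup_le {S : Subgroup (PushoutAmbient f g)}
    (hS : IsClosed (S : Set (PushoutAmbient f g))) (hl : ∀ x, pushoutInl f g x ∈ S)
    (hr : ∀ x, pushoutInr f g x ∈ S) : pushoutSubgroup f g ≤ S := by
  refine Subgroup.topologicalClosure_minimal _ (sup_le ?_ ?_) hS
  · rintro _ ⟨x, rfl⟩
    exact hl x
  · rintro _ ⟨x, rfl⟩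
    exact hr x

/-- The pushout of compact groups. -/
noncomputable def pushoutObj : CompactGrp.{u} := of (pushoutSubgroup f g)

/-- The first structure map of the pushout. -/
noncomputable def inl : G₁ ⟶ pushoutObj f g :=
  ⟨⟨(pushoutInl f g).toMonoidHom.codRestrict _ (pushoutInl_mem f g),
    (pushoutInl f g).continuous.subtype_mk (pushoutInl_mem f g)⟩⟩

/-- The second structure map of the pushout. -/
noncomputable def inr : G₂ ⟶ pushoutObj f g :=
  ⟨⟨(pushoutInr f g).toMonoidHom.codRestrict _ (pushoutInr_mem f g),
    (pushoutInr f g).continuous.subtype_mk (pushoutInr_mem f g)⟩⟩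

theorem comp_inl_eq : f ≫ inl f g = g ≫ inr f g := by
  refine ConcreteCategory.hom_ext _ _ fun h => ?_
  exact Subtype.ext (funext fun j => j.2.2 h)

/-- Composing a representation of `K` with `a` and `b` gives a compatible pair, so reindexing maps
the ambient product to the one containing `K`. The generators land in `K`, which is closed there, so
the whole pushout does. -/
theorem exists_pushout_desc {K : CompactGrp.{u}} (a : G₁ ⟶ K) (b : G₂ ⟶ K) (h : f ≫ a = g ≫ b) :
    ∃ m : pushoutObj f g ⟶ K, inl f g ≫ m = a ∧ inr f g ≫ m = b := by
  let L := ∀ j : (Σ n, K →ₜ* OrthogonalOperators n), OrthogonalOperators j.1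
  let i : K →ₜ* L :=
    ⟨MonoidHom.pi fun j => j.2.toMonoidHom, continuous_pi fun j => j.2.continuous⟩
  have hi : IsClosedEmbedding i := isClosedEmbedding_pi_orthogonalOperators K
  let idx (j : Σ n, K →ₜ* OrthogonalOperators n) : PushoutIndex f g :=
    ⟨j.1, ⟨(j.2.comp a.hom', j.2.comp b.hom'),
      fun x => congrArg j.2 (ConcreteCategory.congr_hom h x)⟩⟩
  let q : PushoutAmbient f g →ₜ* L :=
    ⟨MonoidHom.pi fun j => Pi.evalMonoidHom _ (idx j), continuous_pi fun j => continuous_apply _⟩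
  have hq : pushoutSubgroup f g ≤ i.toMonoidHom.range.comap q.toMonoidHom := by
    refine pushoutSubgroup_le f g (hi.isClosed_range.preimage q.continuous) ?_ ?_
    · exact fun x => ⟨a.hom' x, rfl⟩
    · exact fun x => ⟨b.hom' x, rfl⟩
  obtain ⟨ψ, hψ⟩ := ContinuousMonoidHom.exists_lift_of_isEmbedding i hi.isEmbedding
    (⟨q.toMonoidHom.comp (pushoutSubgroup f g).subtype,
      q.continuous.comp continuous_subtype_val⟩ : pushoutSubgroup f g →ₜ* L) fun s => hq s.2
  refine ⟨⟨ψ⟩, ?_, ?_⟩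
  · ext x
    exact hi.injective (hψ _)
  · ext x
    exact hi.injective (hψ _)

/-- The agreement locus is a closed subgroup containing the generators. -/
theorem pushoutSubgroup_hom_ext {K : Type*} [Group K] [TopologicalSpace K] [T2Space K]
    {φ ψ : pushoutSubgroup f g →ₜ* K}
    (hl : ∀ x, φ ⟨_, pushoutInl_mem f g x⟩ = ψ ⟨_, pushoutInl_mem f g x⟩)
    (hr : ∀ x, φ ⟨_, pushoutInr_mem f g x⟩ = ψ ⟨_, pushoutInr_mem f g x⟩) : φ = ψ := by
  let S : Subgroup (pushoutSubgroup f g) := φ.toMonoidHom.eqLocus ψ.toMonoidHom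
  have hS : IsClosed (S : Set (pushoutSubgroup f g)) := isClosed_eq φ.continuous ψ.continuous
  have hle : pushoutSubgroup f g ≤ S.map (pushoutSubgroup f g).subtype := by
    refine pushoutSubgroup_le f g
      ((isClosed_pushoutSubgroup f g).isClosedEmbedding_subtypeVal.isClosedMap _ hS) ?_ ?_
    · exact fun x => ⟨⟨_, pushoutInl_mem f g x⟩, hl x, rfl⟩
    · exact fun x => ⟨⟨_, pushoutInr_mem f g x⟩, hr x, rfl⟩
  ext s
  obtain ⟨t, ht, hts⟩ := hle s.2
  obtain rfl : t = s := Subtype.ext hts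
  exact ht

theorem pushout_hom_ext {K : CompactGrp.{u}} {m m' : pushoutObj f g ⟶ K}
    (hl : inl f g ≫ m = inl f g ≫ m') (hr : inr f g ≫ m = inr f g ≫ m') : m = m' :=
  Hom.ext (pushoutSubgroup_hom_ext f g (φ := m.hom') (ψ := m'.hom')
    (ConcreteCategory.congr_hom hl) (ConcreteCategory.congr_hom hr))

theorem isPushout_inl_inr : IsPushout f g (inl f g) (inr f g) where
  w := comp_inl_eq f g
  isColimit' := by
    have hex (s : PushoutCocone f g) := exists_pushout_desc f g s.inl s.inr s.condition
    choose d hd using hex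
    exact ⟨PushoutCocone.IsColimit.mk _ d (fun s => (hd s).1) (fun s => (hd s).2)
      fun s m hl hr => pushout_hom_ext f g (hl.trans (hd s).1.symm) (hr.trans (hd s).2.symm)⟩

end Pushout

/-! ### Equalizers and embeddings -/

variable {H G : CompactGrp.{u}} {f : H ⟶ G}

/-- The cokernel pair of an embedding separates the points outside its range. -/
theorem IsEmbedding.mem_range_of_inl_eq_inr (hf : IsEmbedding f) {x : G}
    (hx : ConcreteCategory.hom (inl f f) x = ConcreteCategory.hom (inr f f) x) :
    ∃ y, ConcreteCategory.hom f y = x := by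
  by_contra hne
  have hcl : IsClosed (f.hom'.toMonoidHom.range : Set G) :=
    (f.hom'.continuous.isClosedEmbedding hf.injective).isClosed_range
  obtain ⟨n, a, b, hab, hx'⟩ := exists_continuousMonoidHom_pair f.hom'.toMonoidHom.range hcl hne
  exact hx' (congrFun (congrArg Subtype.val hx) ⟨n, (a, b), fun h => hab _ ⟨h, rfl⟩⟩)

theorem IsEmbedding.nonempty_isLimit_fork (hf : IsEmbedding f) {P : CompactGrp.{u}} {a b : G ⟶ P}
    (w : f ≫ a = f ≫ b)
    (h : ∀ x, ConcreteCategory.hom a x = ConcreteCategory.hom b x →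
      ∃ y, ConcreteCategory.hom f y = x) :
    Nonempty (IsLimit (Fork.ofι f w)) := by
  have hex (s : Fork a b) : ∃ l : s.pt ⟶ H, l ≫ f = s.ι := by
    obtain ⟨ψ, hψ⟩ := ContinuousMonoidHom.exists_lift_of_isEmbedding f.hom' hf s.ι.hom'
      fun t => h _ (ConcreteCategory.congr_hom s.condition t)
    exact ⟨⟨ψ⟩, by ext t; exact hψ t⟩
  choose l hl using hex
  refine ⟨Fork.IsLimit.mk _ l hl fun s m hm => ?_⟩
  ext t
  exact hf.injective (ConcreteCategory.congr_hom (hm.trans (hl s).symm) t)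

theorem IsEmbedding.nonempty_isLimit_fork_of_isPushout (hf : IsEmbedding f) {P : CompactGrp.{u}}
    {a b : G ⟶ P} (h : IsPushout f f a b) : Nonempty (IsLimit (Fork.ofι f h.w)) := by
  refine hf.nonempty_isLimit_fork h.w fun x hx => hf.mem_range_of_inl_eq_inr ?_
  -- Points identified in any pushout are identified in the concrete one, through the comparison
  -- map.
  have hl := ConcreteCategory.congr_hom (h.inl_desc _ _ (comp_inl_eq f f)) x
  have hr := ConcreteCategory.congr_hom (h.inr_desc _ _ (comp_inl_eq f f)) x
  rw [← hl, ← hr, ConcreteCategory.comp_apply, ConcreteCategory.comp_apply, hx]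

/-- Lifting the agreement subgroup `S` through the equalizer gives a left inverse to the
corestriction of `f` to `S`, so `f` is injective. -/
theorem isEmbedding_of_isLimit_fork {K : CompactGrp.{u}} {a b : G ⟶ K} (w : f ≫ a = f ≫ b)
    (hl : IsLimit (Fork.ofι f w)) : IsEmbedding f := by
  let S : Subgroup G := a.hom'.toMonoidHom.eqLocus b.hom'.toMonoidHom
  have hS : IsClosed (S : Set G) := isClosed_eq a.hom'.continuous b.hom'.continuous
  have : CompactSpace S := isCompact_iff_compactSpace.1 hS.isCompact
  let i : of S ⟶ G := ⟨⟨S.subtype, continuous_subtype_val⟩⟩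
  have hi : i ≫ a = i ≫ b := by
    ext s
    exact s.2
  let l : of S ⟶ H := Fork.IsLimit.lift hl i hi
  have hli : l ≫ f = i := Fork.IsLimit.lift_ι hl
  have hfS (x : H) : ConcreteCategory.hom f x ∈ S := ConcreteCategory.congr_hom w x
  let r : H ⟶ of S :=
    ⟨⟨f.hom'.toMonoidHom.codRestrict S hfS, f.hom'.continuous.subtype_mk hfS⟩⟩
  have hri : r ≫ i = f := rfl
  have hrl : r ≫ l = 𝟙 H := by
    refine Fork.IsLimit.hom_ext hl ?_
    change (r ≫ l) ≫ f = 𝟙 H ≫ f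
    rw [Category.assoc, hli, hri, Category.id_comp]
  have hinj : Function.Injective (ConcreteCategory.hom f) := by
    intro x y hxy
    have hr : ConcreteCategory.hom r x = ConcreteCategory.hom r y := Subtype.ext hxy
    have hx := ConcreteCategory.congr_hom hrl x
    have hy := ConcreteCategory.congr_hom hrl y
    rw [ConcreteCategory.comp_apply] at hx hy
    rw [hr, hy] at hx
    exact hx.symm
  exact (f.hom'.continuous.isClosedEmbedding hinj).isEmbedding

end CompactGrp

theorem mainTheorem1 :
    (∀ (H G : CompactGrp.{u}) (f : H ⟶ G), IsRegularMono f ↔ CompactGrp.IsEmbedding f) ∧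
    (∀ (H G : CompactGrp.{u}) (f : H ⟶ G), CompactGrp.IsEmbedding f →
      HasPushout f f ∧
      ∀ (P : CompactGrp.{u}) (inl inr : G ⟶ P) (h : IsPushout f f inl inr),
        Nonempty (IsLimit (Fork.ofι f h.w))) := by
  refine ⟨fun H G f => ⟨?_, fun hf => ?_⟩, fun H G f hf => ⟨?_, ?_⟩⟩
  · rintro ⟨⟨h⟩⟩
    exact CompactGrp.isEmbedding_of_isLimit_fork h.w h.isLimit
  · obtain ⟨hl⟩ := hf.nonempty_isLimit_fork_of_isPushout (CompactGrp.isPushout_inl_inr f f)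
    exact ⟨⟨⟨_, _, _, _, hl⟩⟩⟩
  · exact (CompactGrp.isPushout_inl_inr f f).hasPushout
  · exact fun P inl inr h => hf.nonempty_isLimit_fork_of_isPushout h
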